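/- A \emph{$k$-dimensional torus} is a Cartesian product $G=\gamma_1\times\cdots\times\gamma_k$ of undirected cycles $\gamma_i$, each with $|\gamma_i|\ge 2$ vertices (the cycle on two vertices being a single edge); two vertices of $G$ are adjacent when they differ in exactly one coordinate $i$ and are adjacent there in $\gamma_i$, and the edge joining them is then said to lie in dimension $i$. The \emph{run length} $rl(H)$ of a Hamiltonian cycle $H$ of $G$ is the largest $r$ such that any $r$ (cyclically) consecutive edges of $H$ contain at most one edge in any one dimension, and $mrl(G)$ is the maximum of $rl(H)$ over all Hamiltonian cycles $H$ of $G$. Let $p$ be a prime and let $G=\gamma_1\times\gamma_2\times\cdots\times\gamma_{3n}$ be a $3n$-dimensional torus with $|G|=p^r$ vertices for some positive integer $r$. Then $G$ has a Hamiltonian cycle and $mrl(G)\ge n+1$. -/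

import Mathlib

/-- The Cartesian product `γ₁ × ⋯ × γ_k` of a family of graphs: two vertices are adjacent when they
differ in exactly one coordinate `i` and their `i`-th coordinates are adjacent in `γ i`. -/
def gridGraph {ι : Type*} {V : ι → Type*} (γ : ∀ i, SimpleGraph (V i)) :
    SimpleGraph (∀ i, V i) where
  Adj x y := ∃ i, (γ i).Adj (x i) (y i) ∧ ∀ j, j ≠ i → x j = y j
  symm := ⟨by
    rintro x y ⟨i, h, h'⟩
    exact ⟨i, h.symm, fun j hj => (h' j hj).symm⟩⟩
  loopless := ⟨by
    rintro x ⟨i, h, -⟩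
    exact (γ i).loopless.irrefl _ h⟩

/-- The (undirected) torus whose `i`-th dimension is the cycle on `m i` vertices; the cycle on two
vertices is a single edge, so that the torus with all sizes equal to `2` is the `k`-cube. -/
def torus {k : ℕ} (m : Fin k → ℕ) : SimpleGraph (∀ i, Fin (m i)) :=
  gridGraph fun i => SimpleGraph.cycleGraph (m i)

section RunLength

variable {ι : Type*} {V : ι → Type*} {G : SimpleGraph (∀ i, V i)} {v : ∀ i, V i}

/-- The `t`-th edge of the closed walk `H` (edges are numbered cyclically, starting from `0`)
lies in the dimension `i`, i.e. its two ends differ in the `i`-th coordinate. -/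
def EdgeInDim (H : G.Walk v v) (t : ℕ) (i : ι) : Prop :=
  H.getVert (t % H.length) i ≠ H.getVert (t % H.length + 1) i

/-- Any sequence of `r` consecutive edges of the closed walk `H` contains at most one edge in any
one dimension. Sequences may pass through the base point of `H`. -/
def HasRun (H : G.Walk v v) (r : ℕ) : Prop :=
  ∀ t a b : ℕ, a < r → b < r → ∀ i : ι, EdgeInDim H (t + a) i → EdgeInDim H (t + b) i → a = b

/-- The run length `rl(H)`: the maximum `r` with `HasRun H r`. -/
noncomputable def runLength (H : G.Walk v v) : ℕ :=
  sSup {r | HasRun H r}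

/-- The maximum run length `mrl(G)`: the maximum of `rl(H)` over all Hamiltonian cycles `H`
of `G` (and `0` if there is none). -/
noncomputable def mrl [DecidableEq (∀ i, V i)] (G : SimpleGraph (∀ i, V i)) : ℕ :=
  sSup {r | ∃ (v : ∀ i, V i) (H : G.Walk v v), H.IsHamiltonianCycle ∧ r = runLength H}

/-- The maximum in `runLength` is over a set that is bounded by the number of dimensions. -/
theorem HasRun.le_card [Fintype ι] {H : G.Walk v v} (hH : 0 < H.length) {r : ℕ}
    (h : HasRun H r) : r ≤ Fintype.card ι := by
  have key : ∀ t : ℕ, ∃ i, EdgeInDim H t i := fun t => by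
    have hadj := H.adj_getVert_succ (Nat.mod_lt t hH)
    exact Function.ne_iff.mp hadj.ne
  choose d hd using key
  have hinj : Function.Injective fun a : Fin r => d a := fun a b hab => by
    have hab' : d a = d b := hab
    have ha := hd (0 + a)
    have hb := hd (0 + b)
    simp only [zero_add] at ha hb
    refine Fin.ext (h 0 a b a.2 b.2 (d a) ?_ ?_)
    · simpa using ha
    · rw [hab']; simpa using hb
  simpa using Fintype.card_le_of_injective _ hinj

/-- For a closed walk with at least one edge the maximum in `runLength` is attained. -/
theorem isGreatest_runLength [Fintype ι] {H : G.Walk v v} (hH : 0 < H.length) :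
    IsGreatest {r | HasRun H r} (runLength H) := by
  have hb : BddAbove {r | HasRun H r} := ⟨Fintype.card ι, fun r hr => hr.le_card hH⟩
  have hne : {r | HasRun H r}.Nonempty := ⟨0, fun _ a _ ha => absurd ha (Nat.not_lt_zero a)⟩
  exact ⟨Nat.sSup_mem hne hb, fun r hr => le_csSup hb hr⟩

/-- The maximum in `mrl` is attained as soon as `G` has a Hamiltonian cycle. -/
theorem isGreatest_mrl [Fintype ι] [DecidableEq (∀ i, V i)]
    (hG : ∃ (v : ∀ i, V i) (H : G.Walk v v), H.IsHamiltonianCycle) :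
    IsGreatest {r | ∃ (v : ∀ i, V i) (H : G.Walk v v), H.IsHamiltonianCycle ∧ r = runLength H}
      (mrl G) := by
  obtain ⟨v, H, hH⟩ := hG
  have hb : BddAbove {r | ∃ (v : ∀ i, V i) (H : G.Walk v v),
      H.IsHamiltonianCycle ∧ r = runLength H} := by
    refine ⟨Fintype.card ι, ?_⟩
    rintro r ⟨w, K, hK, rfl⟩
    have hl : 0 < K.length := by have := hK.isCycle.three_le_length; omega
    exact (isGreatest_runLength hl).1.le_card hl
  exact ⟨Nat.sSup_mem ⟨_, v, H, hH, rfl⟩ hb, fun r hr => le_csSup hb hr⟩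

end RunLength

/-! The proof is an induction on `n` that halves the set of dimensions. Split them into `3k` and
`3l` with `k + l = n` and `k ≤ l ≤ k + 1`, take codes with runs `k + 1` and `l + 1` on the two
halves, and interleave them evenly, with `s` steps of the first code in every `D` steps, where `D`
is the smaller of the two vertex counts. All sizes being powers of `p`, the interleaving visits
every vertex once as soon as `p ∤ s` (`pow_dvd_sub_and_iff`). Its runs reach `n + 1` if `k/(n+1) ≤
s/D ≤ (k+1)/(n+1)`; this range contains two consecutive integers `s`, and one of them is prime to
`p` (`exists_not_dvd_between`).

The base case is a three-dimensional torus with no two consecutive steps in one dimension. It is a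
cyclic extension of a two-dimensional torus: a path whose projection is a Hamiltonian cycle there,
and whose total displacement generates the kernel, is repeated until it closes
(`hasGrayCode_of_quotient`). Such paths are given by periodic colourings, except for sizes `3, 3^b,
3^e`, which get explicit paths. -/

/-- A cyclic Gray code of the torus with sizes `m`, lifted to `ℤ`: `f t` is the position after `t`
steps and `d t` the dimension of the `t`-th step, the code runs through all vertices of the torus
before it closes up, and any `L` consecutive steps lie in distinct dimensions. -/
structure IsGrayCode {ι : Type} [Fintype ι] (m : ι → ℕ) (L : ℕ) (f : ℕ → ι → ℤ) (d : ℕ → ι) :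
    Prop where
  step_ne : ∀ t i, i ≠ d t → f (t + 1) i = f t i
  step : ∀ t, f (t + 1) (d t) = f t (d t) + 1 ∨ f (t + 1) (d t) = f t (d t) - 1
  dvd_iff : ∀ s t : ℕ, (∀ i, (m i : ℤ) ∣ f s i - f t i) ↔ ((∏ i, m i : ℕ) : ℤ) ∣ (s : ℤ) - t
  inj : ∀ t a b, a < L → b < L → d (t + a) = d (t + b) → a = b

/-- The torus with sizes `m` has a Gray code whose runs have length at least `L`. -/
def HasGrayCode {ι : Type} [Fintype ι] (m : ι → ℕ) (L : ℕ) : Prop :=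
  ∃ f d, IsGrayCode m L f d

/-! ### From integer Gray codes to Hamiltonian cycles -/

namespace SimpleGraph

/-- The walk along a sequence of successively adjacent vertices. -/
def walkOfSeq {V : Type*} {G : SimpleGraph V} {F : ℕ → V} (h : ∀ t, G.Adj (F t) (F (t + 1))) :
    ∀ n, G.Walk (F 0) (F n)
  | 0 => .nil
  | n + 1 => (walkOfSeq h n).concat (h n)

theorem length_walkOfSeq {V : Type*} {G : SimpleGraph V} {F : ℕ → V}
    (h : ∀ t, G.Adj (F t) (F (t + 1))) (n : ℕ) : (walkOfSeq h n).length = n := by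
  induction n with
  | zero => rfl
  | succ n ih => simp [walkOfSeq, ih]

theorem getVert_walkOfSeq {V : Type*} {G : SimpleGraph V} {F : ℕ → V}
    (h : ∀ t, G.Adj (F t) (F (t + 1))) (n t : ℕ) (ht : t ≤ n) :
    (walkOfSeq h n).getVert t = F t := by
  induction n with
  | zero => obtain rfl : t = 0 := by omega
            rfl
  | succ n ih =>
    rw [walkOfSeq, Walk.concat_eq_append, Walk.getVert_append, length_walkOfSeq]
    split_ifs with h'
    · exact ih h'.le
    · obtain rfl | rfl : t = n ∨ t = n + 1 := by omega
      · simp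
      · simp

end SimpleGraph

theorem exists_isHamiltonianCycle_of_seq {V : Type*} [Fintype V] [DecidableEq V]
    {G : SimpleGraph V} {F : ℕ → V} (h : ∀ t, G.Adj (F t) (F (t + 1))) {N : ℕ} (hN : 3 ≤ N)
    (hcard : Fintype.card V = N) (hF : ∀ s t, F s = F t ↔ (N : ℤ) ∣ (s : ℤ) - t) :
    ∃ H : G.Walk (F 0) (F 0), H.IsHamiltonianCycle ∧ H.length = N ∧ ∀ t ≤ N, H.getVert t = F t := by
  have hclose : F N = F 0 := (hF N 0).2 (by simp)
  have hv : ∀ t ≤ N, ((SimpleGraph.walkOfSeq h N).copy rfl hclose).getVert t = F t := fun t ht => by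
    rw [SimpleGraph.Walk.getVert_copy, SimpleGraph.getVert_walkOfSeq h N t ht]
  have hl : ((SimpleGraph.walkOfSeq h N).copy rfl hclose).length = N := by
    rw [SimpleGraph.Walk.length_copy, SimpleGraph.length_walkOfSeq]
  refine ⟨(SimpleGraph.walkOfSeq h N).copy rfl hclose, ?_, hl, hv⟩
  generalize (SimpleGraph.walkOfSeq h N).copy rfl hclose = H at hv hl
  rw [SimpleGraph.Walk.isHamiltonianCycle_iff_isCycle_and_length_eq]
  refine ⟨?_, by rw [hl, hcard]⟩
  rw [SimpleGraph.Walk.isCycle_iff_isPath_tail_and_le_length]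
  refine ⟨?_, by omega⟩
  have hnil : ¬ H.Nil := by
    rw [← SimpleGraph.Walk.length_eq_zero_iff]; omega
  have htl := SimpleGraph.Walk.length_tail_add_one hnil
  rw [← SimpleGraph.Walk.IsPath.getVert_injOn_iff]
  intro s hs t ht hst
  simp only [Set.mem_ofPred_eq] at hs ht
  rw [SimpleGraph.Walk.getVert_tail, SimpleGraph.Walk.getVert_tail, hv _ (by omega),
    hv _ (by omega), hF] at hst
  obtain ⟨k, hk⟩ := hst
  have hk0 : k = 0 := by
    have h1 : (N : ℤ) * k < N * 1 := by push_cast at hk; omega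
    have h2 : (N : ℤ) * (-1) < N * k := by push_cast at hk; omega
    have h3 := lt_of_mul_lt_mul_left h1 (by omega)
    have h4 := lt_of_mul_lt_mul_left h2 (by omega)
    omega
  subst hk0
  push_cast at hk
  omega

/-- The residue of an integer, as a vertex of the cycle on `n` vertices. -/
def residue (n : ℕ) (hn : 2 ≤ n) (z : ℤ) : Fin n :=
  ⟨(z % n).toNat, by
    have h1 := Int.emod_nonneg z (show (n : ℤ) ≠ 0 by omega)
    have h2 := Int.emod_lt_of_pos z (show (0 : ℤ) < n by omega)
    omega⟩

theorem residue_eq_iff {n : ℕ} (hn : 2 ≤ n) (y z : ℤ) :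
    residue n hn y = residue n hn z ↔ (n : ℤ) ∣ y - z := by
  have h1 := Int.emod_nonneg y (show (n : ℤ) ≠ 0 by omega)
  have h2 := Int.emod_nonneg z (show (n : ℤ) ≠ 0 by omega)
  rw [residue, residue, Fin.mk.injEq, dvd_sub_comm, ← Int.modEq_iff_dvd, Int.ModEq]
  omega

theorem cycleGraph_adj_residue_add_one {n : ℕ} (hn : 2 ≤ n) (z : ℤ) :
    (SimpleGraph.cycleGraph n).Adj (residue n hn z) (residue n hn (z + 1)) := by
  have h1 := Int.emod_nonneg z (show (n : ℤ) ≠ 0 by omega)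
  have h2 := Int.emod_lt_of_pos z (show (0 : ℤ) < n by omega)
  rw [SimpleGraph.cycleGraph_adj']
  right
  have key : (z + 1) % n = z % n + 1 ∨ ((z + 1) % n = 0 ∧ z % n + 1 = n) := by
    rw [Int.add_emod, Int.emod_eq_of_lt (a := 1) (by norm_num) (by omega)]
    by_cases h : z % n + 1 = n
    · right; rw [h]; simp
    · left; exact Int.emod_eq_of_lt (by omega) (by omega)
  rw [Fin.val_sub]
  simp only [residue]
  rcases key with h | ⟨h, h'⟩
  · rw [h, show n - (z % n).toNat + (z % n + 1).toNat = 1 + n by omega, Nat.add_mod_right]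
    exact Nat.mod_eq_of_lt (by omega)
  · rw [h, show n - (z % n).toNat + (0 : ℤ).toNat = 1 by omega]
    exact Nat.mod_eq_of_lt (by omega)

/-- Reducing the code modulo the sizes gives a closed walk. By `dvd_iff` its positions recur exactly
with period `∏ i, m i`, so a window passing through the base point of the walk is still a window of
the code. -/
theorem IsGrayCode.le_mrl {k : ℕ} {m : Fin k → ℕ} (hm : ∀ i, 2 ≤ m i) (hN : 3 ≤ ∏ i, m i) {L : ℕ}
    {f : ℕ → Fin k → ℤ} {d : ℕ → Fin k} (h : IsGrayCode m L f d) : L ≤ mrl (torus m) := by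
  let F : ℕ → ∀ i, Fin (m i) := fun t i => residue (m i) (hm i) (f t i)
  have hadj : ∀ t, (torus m).Adj (F t) (F (t + 1)) := fun t => by
    refine ⟨d t, ?_, fun j hj => ?_⟩
    · rcases h.step t with h' | h'
      · simp only [F, h']
        exact cycleGraph_adj_residue_add_one (hm _) _
      · have := (cycleGraph_adj_residue_add_one (hm (d t)) (f (t + 1) (d t))).symm
        simpa only [F, h', sub_add_cancel] using this
    · simp only [F, h.step_ne t j hj]
  have hF : ∀ s t, F s = F t ↔ ((∏ i, m i : ℕ) : ℤ) ∣ (s : ℤ) - t := fun s t => by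
    rw [← h.dvd_iff, funext_iff]
    exact forall_congr' fun i => residue_eq_iff (hm i) _ _
  obtain ⟨H, hH, hl, hv⟩ := exists_isHamiltonianCycle_of_seq hadj hN (by simp) hF
  have hmod : ∀ t, F (t % H.length) = F t := fun t => by
    rw [hF, hl]
    refine ⟨-(t / ∏ i, m i : ℕ), ?_⟩
    have := Nat.mod_add_div t (∏ i, m i)
    zify at this ⊢
    linarith
  have hmod' : ∀ t, F (t % H.length + 1) = F (t + 1) := fun t => by
    have := hmod t
    rw [hF] at this ⊢
    push_cast at this ⊢
    rwa [add_sub_add_right_eq_sub]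
  have hdim : ∀ t i, EdgeInDim H t i → d t = i := fun t i hi => by
    have hlt : t % H.length < H.length := Nat.mod_lt _ (by omega)
    rw [EdgeInDim, hv _ (by omega), hv _ (by omega), hmod, hmod'] at hi
    by_contra hne
    exact hi (by simp only [F, h.step_ne t i (Ne.symm hne)])
  have hrun : HasRun H L := fun t a b ha hb i hai hbi =>
    h.inj t a b ha hb ((hdim _ _ hai).trans (hdim _ _ hbi).symm)
  exact ((isGreatest_runLength (by omega)).2 hrun).trans
    ((isGreatest_mrl ⟨_, H, hH⟩).2 ⟨_, H, hH, rfl⟩)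

/-! ### Interleaving Gray codes on complementary sets of dimensions -/

theorem HasGrayCode.of_equiv {ι κ : Type} [Fintype ι] [Fintype κ] (e : κ ≃ ι) {m : ι → ℕ} {L : ℕ}
    (h : HasGrayCode (m ∘ e) L) : HasGrayCode m L := by
  obtain ⟨f, d, h⟩ := h
  refine ⟨fun t i => f t (e.symm i), fun t => e (d t), ?_, ?_, ?_, ?_⟩
  · intro t i hi
    exact h.step_ne t _ fun h' => hi (by rw [← h', e.apply_symm_apply])
  · intro t
    simpa using h.step t
  · intro s t
    rw [← e.prod_comp]
    refine Iff.trans ⟨fun H i => ?_, fun H i => ?_⟩ (h.dvd_iff s t)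
    · simpa using H (e i)
    · simpa using H (e.symm i)
  · intro t a b ha hb hab
    exact h.inj t a b ha hb (e.injective hab)

/-- Interleaving two Gray codes along a pattern `a`, `b` of a Gray code of a two-dimensional
torus. -/
theorem HasGrayCode.sum {ι κ : Type} [Fintype ι] [Fintype κ] {m : ι → ℕ} {n : κ → ℕ}
    {α β L : ℕ} (hA : HasGrayCode m α) (hB : HasGrayCode n β) {a b : ℕ → ℕ}
    (hab : ∀ t, a t + b t = t) (hstep : ∀ t, a (t + 1) = a t ∨ a (t + 1) = a t + 1)
    (ha : ∀ t, a (t + L) ≤ a t + α) (hb : ∀ t, b (t + L) ≤ b t + β)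
    (hdvd : ∀ s t, (((∏ i, m i : ℕ) : ℤ) ∣ (a s : ℤ) - a t ∧
      ((∏ i, n i : ℕ) : ℤ) ∣ (b s : ℤ) - b t) ↔
      (((∏ i, m i) * (∏ i, n i) : ℕ) : ℤ) ∣ (s : ℤ) - t) :
    HasGrayCode (Sum.elim m n) L := by
  obtain ⟨f, d, hf⟩ := hA
  obtain ⟨g, e, hg⟩ := hB
  have hstep' : ∀ t, (a (t + 1) = a t ∧ b (t + 1) = b t + 1) ∨
      (a (t + 1) = a t + 1 ∧ b (t + 1) = b t) := fun t => by
    have h1 := hab t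
    have h2 := hab (t + 1)
    rcases hstep t with h | h
    · left; omega
    · right; omega
  have hamono : Monotone a := monotone_nat_of_le_succ fun t => by
    rcases hstep' t with h | h <;> omega
  have hbmono : Monotone b := monotone_nat_of_le_succ fun t => by
    rcases hstep' t with h | h <;> omega
  refine ⟨fun t => Sum.elim (f (a t)) (g (b t)),
    fun t => if a (t + 1) = a t then Sum.inr (e (b t)) else Sum.inl (d (a t)), ?_, ?_, ?_, ?_⟩
  · rintro t (i | i) hi
    · rcases hstep' t with h | h
      · simp [h]
      · simp only [h, Nat.succ_ne_self, if_false, Sum.elim_inl] at hi ⊢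
        exact hf.step_ne _ _ fun h' => hi (by rw [h'])
    · rcases hstep' t with h | h
      · simp only [h, if_true, Sum.elim_inr] at hi ⊢
        exact hg.step_ne _ _ fun h' => hi (by rw [h'])
      · simp [h]
  · intro t
    rcases hstep' t with h | h
    · simpa [h] using hg.step (b t)
    · simpa [h] using hf.step (a t)
  · intro s t
    rw [Fintype.prod_sum_type]
    simp only [Sum.elim_inl, Sum.elim_inr, Sum.forall]
    rw [hf.dvd_iff, hg.dvd_iff]
    exact hdvd s t
  -- The window of length `L` is moved to start at the earlier step `t + x`. It still contains step
  -- `t + y`, so two steps of the same kind are fewer than `α` (or `β`) apart in their own code.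
  · have key : ∀ t x y, x < y → y < L →
        (if a (t + x + 1) = a (t + x) then (Sum.inr (e (b (t + x))) : ι ⊕ κ)
          else Sum.inl (d (a (t + x)))) =
        (if a (t + y + 1) = a (t + y) then Sum.inr (e (b (t + y)))
          else Sum.inl (d (a (t + y)))) → False := by
      intro t x y hxy hy h
      rcases hstep' (t + x) with hx | hx <;> rcases hstep' (t + y) with hy' | hy'
      · simp only [hx, hy', if_true, Sum.inr.injEq] at h
        have h1 := hbmono (show t + y + 1 ≤ t + x + L by omega)
        have h2 := hb (t + x)
        have h3 := hbmono (show t + x + 1 ≤ t + y by omega)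
        have := hg.inj (b (t + x)) 0 (b (t + y) - b (t + x)) (by omega) (by omega)
          (by rw [Nat.add_zero, Nat.add_sub_cancel' (by omega)]; exact h)
        omega
      · simp [hx, hy'] at h
      · simp [hx, hy'] at h
      · simp only [hx, hy', Nat.succ_ne_self, if_false, Sum.inl.injEq] at h
        have h1 := hamono (show t + y + 1 ≤ t + x + L by omega)
        have h2 := ha (t + x)
        have h3 := hamono (show t + x + 1 ≤ t + y by omega)
        have := hf.inj (a (t + x)) 0 (a (t + y) - a (t + x)) (by omega) (by omega)
          (by rw [Nat.add_zero, Nat.add_sub_cancel' (by omega)]; exact h)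
        omega
    intro t x y hx hy h
    rcases lt_trichotomy x y with h' | h' | h'
    · exact (key t x y h' hy h).elim
    · exact h'
    · exact (key t y x h' hx h.symm).elim

/-- A pattern of period `p ^ min a b` with `s` steps of the first kind, `s` coprime to `p`, runs
through all vertices of the directed torus with sizes `p ^ a` and `p ^ b`. -/
theorem pow_dvd_sub_and_iff {p : ℕ} (hp : p.Prime) {a b s : ℕ} (hab : 0 < min a b)
    (hs : ¬ p ∣ s) {x y : ℕ → ℕ} (hxy : ∀ t, x t + y t = t)
    (hx : ∀ t, x (t + p ^ min a b) = x t + s) (u v : ℕ) :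
    (((p ^ a : ℕ) : ℤ) ∣ (x u : ℤ) - x v ∧ ((p ^ b : ℕ) : ℤ) ∣ (y u : ℤ) - y v) ↔
      ((p ^ a * p ^ b : ℕ) : ℤ) ∣ (u : ℤ) - v := by
  obtain ⟨D, hD⟩ : ∃ D, D = p ^ min a b := ⟨_, rfl⟩
  have hD0 : 0 < D := hD ▸ pow_pos hp.pos _
  have hmul : p ^ a * p ^ b = D * p ^ max a b := by
    rw [hD, ← pow_add, ← pow_add, min_add_max]
  have hpD : p ∣ D := hD ▸ dvd_pow_self p hab.ne'
  rw [← hD] at hx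
  have hxq : ∀ q t, x (t + D * q) = x t + s * q := fun q t => by
    induction q with
    | zero => rfl
    | succ q ih => rw [Nat.mul_succ, ← add_assoc, hx, ih, Nat.mul_succ, add_assoc]
  have hsle : s ≤ D := by
    have h1 := hx 0
    have h2 := hxy (0 + D)
    omega
  have hcop : IsCoprime (p : ℤ) s := by
    rw [Nat.isCoprime_iff_coprime]; exact (hp.coprime_iff_not_dvd).2 hs
  have hcop' : IsCoprime (p : ℤ) ((D : ℤ) - s) := by
    rw [← Nat.cast_sub hsle, Nat.isCoprime_iff_coprime]
    exact (hp.coprime_iff_not_dvd).2 fun h => hs ((Nat.dvd_sub_iff_right hsle hpD).1 h)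
  have hdiff : ∀ u v : ℕ, ∀ k : ℤ, (u : ℤ) - v = D * k →
      (x u : ℤ) - x v = s * k ∧ (y u : ℤ) - y v = (D - s) * k := by
    have pos : ∀ u v q : ℕ, u = v + D * q →
        (x u : ℤ) - x v = s * q ∧ (y u : ℤ) - y v = (D - s) * q := by
      rintro u v q rfl
      have h1 := hxq q v
      have h2 := hxy v
      have h3 := hxy (v + D * q)
      zify at h1 h2 h3
      constructor <;> linarith
    intro u v k hk
    obtain ⟨q, rfl | rfl⟩ := k.eq_nat_or_neg
    · exact pos u v q (by zify; linarith)
    · have := pos v u q (by zify; linarith)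
      constructor <;> linarith [this.1, this.2]
  constructor
  · rintro ⟨h1, h2⟩
    have hDa : (D : ℤ) ∣ ((p ^ a : ℕ) : ℤ) := by
      rw [hD]; exact_mod_cast pow_dvd_pow p (min_le_left a b)
    have hDb : (D : ℤ) ∣ ((p ^ b : ℕ) : ℤ) := by
      rw [hD]; exact_mod_cast pow_dvd_pow p (min_le_right a b)
    have hD' : (D : ℤ) ∣ (u : ℤ) - v := by
      have := dvd_add (hDa.trans h1) (hDb.trans h2)
      have h3 := hxy u
      have h4 := hxy v
      zify at h3 h4
      rwa [show (u : ℤ) - v = (x u : ℤ) - x v + ((y u : ℤ) - y v) by linarith]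
    obtain ⟨k, hk⟩ := hD'
    obtain ⟨e1, e2⟩ := hdiff u v k hk
    rw [e1] at h1
    rw [e2] at h2
    -- The displacements per period, `s` and `D - s`, are both prime to `p`, so the larger of the
    -- two cycles determines `k`.
    have : ((p ^ max a b : ℕ) : ℤ) ∣ k := by
      push_cast at h1 h2 ⊢
      rcases le_total a b with h | h
      · rw [max_eq_right h]
        exact (hcop'.pow_left).dvd_of_dvd_mul_left h2
      · rw [max_eq_left h]
        exact (hcop.pow_left).dvd_of_dvd_mul_left h1
    rw [hk, hmul, Nat.cast_mul]
    exact mul_dvd_mul_left _ this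
  · intro h
    rw [hmul, Nat.cast_mul] at h
    obtain ⟨j, hj⟩ := h
    obtain ⟨e1, e2⟩ := hdiff u v _ (by rw [hj, mul_assoc])
    have ha : ((p ^ a : ℕ) : ℤ) ∣ ((p ^ max a b : ℕ) : ℤ) := by
      exact_mod_cast pow_dvd_pow p (le_max_left a b)
    have hb : ((p ^ b : ℕ) : ℤ) ∣ ((p ^ max a b : ℕ) : ℤ) := by
      exact_mod_cast pow_dvd_pow p (le_max_right a b)
    rw [e1, e2]
    exact ⟨(ha.mul_right j).mul_left _, (hb.mul_right j).mul_left _⟩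

/-- The pattern is `⌊t s / D⌋`, which spreads the steps of the first kind as evenly as possible. The
bounds `hα` and `hβ` on the average then hold in every window, since adding an integer commutes with
the floor. -/
theorem HasGrayCode.sum_of_balanced {p : ℕ} (hp : p.Prime) {ι κ : Type} [Fintype ι] [Fintype κ]
    {m : ι → ℕ} {n : κ → ℕ} {α β L a b s : ℕ} (hA : HasGrayCode m α) (hB : HasGrayCode n β)
    (hm : ∏ i, m i = p ^ a) (hn : ∏ i, n i = p ^ b) (hab : 0 < min a b) (hs : ¬ p ∣ s)
    (hsle : s ≤ p ^ min a b) (hα : L * s ≤ α * p ^ min a b)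
    (hβ : L * p ^ min a b ≤ L * s + β * p ^ min a b) :
    HasGrayCode (Sum.elim m n) L := by
  obtain ⟨D, hD⟩ : ∃ D, D = p ^ min a b := ⟨_, rfl⟩
  have hD0 : 0 < D := hD ▸ pow_pos hp.pos _
  rw [← hD] at hsle hα hβ
  have hle : ∀ t, t * s / D ≤ t := fun t => by
    calc t * s / D ≤ t * D / D := Nat.div_le_div_right (Nat.mul_le_mul_left t hsle)
      _ = t := Nat.mul_div_cancel _ hD0
  refine hA.sum hB (a := fun t => t * s / D) (b := fun t => t - t * s / D) ?_ ?_ ?_ ?_ ?_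
  · intro t
    exact Nat.add_sub_cancel' (hle t)
  · intro t
    have h1 : t * s / D ≤ (t + 1) * s / D := Nat.div_le_div_right (by gcongr; omega)
    have h2 : (t + 1) * s / D ≤ (t * s + 1 * D) / D := Nat.div_le_div_right (by linarith)
    rw [Nat.add_mul_div_right _ _ hD0] at h2
    omega
  · intro t
    rw [← Nat.add_mul_div_right _ _ hD0]
    exact Nat.div_le_div_right (by linarith)
  · intro t
    have h1 : (t * s + L * D) / D ≤ ((t + L) * s + β * D) / D :=
      Nat.div_le_div_right (by linarith)
    rw [Nat.add_mul_div_right _ _ hD0, Nat.add_mul_div_right _ _ hD0] at h1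
    have h2 := hle t
    omega
  · intro u v
    rw [hm, hn]
    refine pow_dvd_sub_and_iff hp hab hs (fun t => Nat.add_sub_cancel' (hle t)) (fun t => ?_) u v
    rw [← hD, Nat.add_mul, Nat.mul_comm D s, Nat.add_mul_div_right _ _ hD0]

/-- With `s = ⌈k D / (n + 1)⌉`, rounding costs at most `n` and passing to `s + 1` costs `n + 1`
more. Hence `D ≥ 2 n + 1` leaves room for both `s` and `s + 1`, and `p` cannot divide both. -/
theorem exists_not_dvd_between {p : ℕ} (hp : p.Prime) {k n D : ℕ} (hk : 0 < k) (hkn : k < n)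
    (hD : 2 * n + 1 ≤ D) :
    ∃ s, ¬ p ∣ s ∧ s ≤ D ∧ k * D ≤ (n + 1) * s ∧ (n + 1) * s ≤ (k + 1) * D := by
  obtain ⟨s, hs1, hs2⟩ : ∃ s, k * D ≤ (n + 1) * s ∧ (n + 1) * s ≤ k * D + n := by
    refine ⟨(k * D + n) / (n + 1), ?_, Nat.mul_div_le _ _⟩
    have := Nat.lt_mul_div_succ (k * D + n) (Nat.succ_pos n)
    simp only [Nat.succ_eq_add_one, Nat.mul_add, Nat.mul_one] at this ⊢
    omega
  have h3 : (n + 1) * (s + 1) ≤ (k + 1) * D := by nlinarith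
  have h4 : s + 1 ≤ D := by
    have : (n + 1) * (s + 1) ≤ (n + 1) * D := h3.trans (by gcongr)
    exact Nat.le_of_mul_le_mul_left this (by omega)
  by_cases h : p ∣ s
  · refine ⟨s + 1, fun h' => hp.one_lt.ne' ?_, h4, by nlinarith, h3⟩
    exact Nat.dvd_one.1 ((Nat.dvd_add_right h).1 h')
  · exact ⟨s, h, by omega, hs1, by nlinarith⟩

/-- Reduction of the general case to three-dimensional tori. -/
theorem hasGrayCode_of_three {p : ℕ} (hp : p.Prime)
    (h3 : ∀ c : Fin 3 → ℕ, (∀ i, 0 < c i) → HasGrayCode (fun i => p ^ c i) 2) (n : ℕ) (hn : 0 < n)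
    (ι : Type) [Fintype ι] (hι : Fintype.card ι = 3 * n) (c : ι → ℕ) (hc : ∀ i, 0 < c i) :
    HasGrayCode (fun i => p ^ c i) (n + 1) := by
  induction n using Nat.strong_induction_on generalizing ι with
  | _ n ih =>
  rcases Nat.eq_or_lt_of_le (Nat.succ_le_of_lt hn) with h | h
  · obtain rfl : n = 1 := h.symm
    let e : Fin 3 ≃ ι := (Fintype.equivFinOfCardEq hι).symm
    exact HasGrayCode.of_equiv e (h3 (c ∘ e) fun i => hc _)
  · obtain ⟨k, l, hkl, hk, hkl1, hkl2⟩ : ∃ k l, k + l = n ∧ 0 < k ∧ k ≤ l ∧ l ≤ k + 1 :=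
      ⟨n / 2, n - n / 2, by omega, by omega, by omega, by omega⟩
    let e : Fin (3 * k) ⊕ Fin (3 * l) ≃ ι :=
      finSumFinEquiv.trans ((finCongr (by omega)).trans (Fintype.equivFinOfCardEq hι).symm)
    have hA := ih k (by omega) hk (Fin (3 * k)) (by simp) (fun i => c (e (Sum.inl i)))
      fun i => hc _
    have hB := ih l (by omega) (by omega) (Fin (3 * l)) (by simp) (fun i => c (e (Sum.inr i)))
      fun i => hc _
    have hle : ∀ (j : ℕ) (g : Fin (3 * j) → ℕ), (∀ i, 0 < g i) → 3 * j ≤ ∑ i, g i :=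
      fun j g hg => by
        simpa using Finset.card_nsmul_le_sum Finset.univ g 1 fun i _ => hg i
    have hA' := hle k (fun i => c (e (Sum.inl i))) fun i => hc _
    have hB' := hle l (fun i => c (e (Sum.inr i))) fun i => hc _
    -- Each half has at least `3 k` dimensions, hence at least `8 ^ k` vertices, while `n ≤ 2 k +
    -- 1`.
    have hD : 2 * n + 1 ≤
        p ^ min (∑ i, c (e (Sum.inl i))) (∑ i, c (e (Sum.inr i))) := by
      have h1 : 4 * k + 3 ≤ 8 ^ k := by
        clear * - hk
        induction k, hk using Nat.le_induction with
        | base => norm_num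
        | succ k hk ih => rw [pow_succ]; omega
      calc 2 * n + 1 ≤ 8 ^ k := by omega
        _ = 2 ^ (3 * k) := by rw [pow_mul]; norm_num
        _ ≤ p ^ (3 * k) := Nat.pow_le_pow_left hp.two_le _
        _ ≤ _ := Nat.pow_le_pow_right hp.pos (by omega)
    obtain ⟨s, hs, hsD, hs1, hs2⟩ := exists_not_dvd_between hp hk (by omega) hD
    have := hA.sum_of_balanced hp hB (L := n + 1) (s := s) (Finset.prod_pow_eq_pow_sum _ _ _)
      (Finset.prod_pow_eq_pow_sum _ _ _) (by omega) hs hsD hs2 (by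
        have : n + 1 = k + (l + 1) := by omega
        nlinarith)
    refine HasGrayCode.of_equiv e ?_
    convert this using 1
    ext (i | i) <;> rfl

/-! ### Three-dimensional tori as extensions of two-dimensional ones -/

/-- A Gray code of a three-dimensional torus from a Gray code `c` of the two-dimensional torus in
which a step in dimension `2` is read as a step by `(α, β)`. The positions of the code are `P`. -/
theorem hasGrayCode_of_quotient {m : Fin 3 → ℕ} {α β : ℤ} (hα : (m 0 : ℤ) ∣ α * m 2)
    (hβ : (m 1 : ℤ) ∣ β * m 2) {P : ℕ → Fin 3 → ℤ} {c : ℕ → Fin 3} {N : ℕ} (hN : N = m 0 * m 1)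
    (hN0 : 0 < N) (h0 : ∀ i, P 0 i = 0)
    (hne : ∀ t < N, ∀ i, i ≠ c t → P (t + 1) i = P t i)
    (hstep : ∀ t < N, P (t + 1) (c t) = P t (c t) + 1 ∨ P (t + 1) (c t) = P t (c t) - 1)
    (hc : ∀ t, t + 1 < N → c t ≠ c (t + 1)) (hc0 : c (N - 1) ≠ c 0)
    (hinj : ∀ s < N, ∀ t < N, (m 0 : ℤ) ∣ (P s 0 + α * P s 2) - (P t 0 + α * P t 2) →
      (m 1 : ℤ) ∣ (P s 1 + β * P s 2) - (P t 1 + β * P t 2) → s = t)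
    (hT0 : (m 0 : ℤ) ∣ P N 0 + α * P N 2) (hT1 : (m 1 : ℤ) ∣ P N 1 + β * P N 2)
    (hT2 : IsCoprime (m 2 : ℤ) (P N 2)) : HasGrayCode m 2 := by
  have hsucc : ∀ t, ((t + 1) / N = t / N ∧ (t + 1) % N = t % N + 1 ∧ t % N + 1 < N) ∨
      ((t + 1) / N = t / N + 1 ∧ (t + 1) % N = 0 ∧ t % N + 1 = N) := fun t => by
    have h1 := Nat.mod_add_div t N
    have h2 := Nat.mod_lt t hN0
    by_cases h : t % N + 1 < N
    · left
      have h3 : t + 1 = t % N + 1 + N * (t / N) := by omega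
      refine ⟨?_, ?_, h⟩
      · conv_lhs => rw [h3, Nat.add_mul_div_left _ _ hN0, Nat.div_eq_of_lt h, zero_add]
      · conv_lhs => rw [h3, Nat.add_mul_mod_self_left, Nat.mod_eq_of_lt h]
    · right
      have h3 : t + 1 = N * (t / N + 1) := by rw [Nat.mul_succ]; omega
      refine ⟨?_, ?_, by omega⟩
      · conv_lhs => rw [h3, Nat.mul_div_cancel_left _ hN0]
      · conv_lhs => rw [h3, Nat.mul_mod_right]
  -- As `P` starts at the origin, the end of one copy of the path is the start of its translate by
  -- `P N`.
  have hsucc' : ∀ t i, (((t + 1) / N : ℕ) : ℤ) * P N i + P ((t + 1) % N) i =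
      ((t / N : ℕ) : ℤ) * P N i + P (t % N + 1) i := fun t i => by
    rcases hsucc t with ⟨h1, h2, -⟩ | ⟨h1, h2, h3⟩
    · rw [h1, h2]
    · rw [h1, h2, h3, h0]; push_cast; ring
  refine ⟨fun t i => ((t / N : ℕ) : ℤ) * P N i + P (t % N) i, fun t => c (t % N), ?_, ?_, ?_, ?_⟩
  · intro t i hi
    simp only [hsucc', hne _ (Nat.mod_lt t hN0) i hi]
  · intro t
    simp only [hsucc']
    rcases hstep _ (Nat.mod_lt t hN0) with h | h
    · left; rw [h]; ring
    · right; rw [h]; ring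
  · intro s t
    have hs := Nat.mod_add_div s N
    have ht := Nat.mod_add_div t N
    zify at hs ht
    have hprod : ((∏ i, m i : ℕ) : ℤ) = N * m 2 := by
      rw [Fin.prod_univ_three, hN]; push_cast; ring
    rw [hprod, Fin.forall_fin_succ, Fin.forall_fin_two]
    simp only [Fin.succ_zero_eq_one, Fin.succ_one_eq_two]
    generalize hq : ((s / N : ℕ) : ℤ) = q at hs ⊢
    generalize hq' : ((t / N : ℕ) : ℤ) = q' at ht ⊢
    have hq1 : (s : ℤ) / N = q := by rw [← hq]; push_cast; rfl
    have hq2 : (t : ℤ) / N = q' := by rw [← hq']; push_cast; rfl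
    rw [hq1] at hs
    rw [hq2] at ht
    constructor
    · rintro ⟨d0, d1, d2⟩
      -- The map `(x, y, z) ↦ (x + α z, y + β z)` kills the displacement `P N`, so only the
      -- positions within one copy matter; the third coordinate then determines the copy modulo `m
      -- 2`.
      have key : s % N = t % N := by
        refine hinj _ (Nat.mod_lt _ hN0) _ (Nat.mod_lt _ hN0) ?_ ?_
        · have h1 := hα.trans (mul_dvd_mul_left α d2)
          have h2 := (d0.add h1).sub (hT0.mul_left (q - q'))
          exact h2.trans (dvd_of_eq (by ring))
        · have h1 := hβ.trans (mul_dvd_mul_left β d2)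
          have h2 := (d1.add h1).sub (hT1.mul_left (q - q'))
          exact h2.trans (dvd_of_eq (by ring))
      rw [key] at d2
      have h3 : (m 2 : ℤ) ∣ q - q' := by
        refine hT2.dvd_of_dvd_mul_right ?_
        exact d2.trans (dvd_of_eq (by ring))
      have key' : (s : ℤ) % N = t % N := by exact_mod_cast key
      have h4 : (s : ℤ) - t = N * (q - q') := by rw [← hs, ← ht, key']; ring
      rw [h4]
      exact mul_dvd_mul_left _ h3
    · rintro ⟨j, hj⟩
      have key' : (s : ℤ) % N = t % N :=
        Int.ModEq.symm (Int.modEq_iff_dvd.2 ⟨m 2 * j, by rw [hj]; ring⟩)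
      have key : s % N = t % N := by exact_mod_cast key'
      have h4 : (N : ℤ) * (q - q') = N * (m 2 * j) := by
        rw [← mul_assoc, ← hj, ← hs, ← ht, key']; ring
      have h5 : q - q' = m 2 * j := mul_left_cancel₀ (by exact_mod_cast hN0.ne') h4
      rw [key]
      have h6 : ∀ i, q * P N i + P (t % N) i - (q' * P N i + P (t % N) i) = m 2 * j * P N i :=
        fun i => by rw [← h5]; ring
      rw [h6, h6, h6]
      refine ⟨?_, ?_, (dvd_mul_right _ _).mul_right _⟩
      · have := (hT0.mul_left (m 2 * j)).sub (hα.mul_right (j * P N 2))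
        exact this.trans (dvd_of_eq (by ring))
      · have := (hT1.mul_left (m 2 * j)).sub (hβ.mul_right (j * P N 2))
        exact this.trans (dvd_of_eq (by ring))
  · have key : ∀ t, c (t % N) ≠ c ((t + 1) % N) := fun t => by
      rcases hsucc t with ⟨-, h2, h3⟩ | ⟨-, h2, h3⟩
      · rw [h2]; exact hc _ h3
      · rw [h2, show t % N = N - 1 by omega]; exact hc0
    intro t a b ha hb hab
    interval_cases a <;> interval_cases b
    · rfl
    · exact absurd hab (key t)
    · exact absurd hab.symm (key t)
    · rfl

/-- A two-dimensional pattern of period `D = p ^ a`, whose steps in the first dimension are coloured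
with the dimensions `0` and `2`; the first period is coloured by `g₀`, the others by `g`. -/
theorem hasGrayCode_of_coloring {p : ℕ} (hp : p.Prime) {a b e D : ℕ} (ha : 0 < a) (hab : a ≤ b)
    (hae : a ≤ e) (hD : D = p ^ a) {g₀ g : ℕ → Fin 3}
    (hg1 : ∀ r < D, g₀ r = 1 ↔ g r = 1) (hr : ¬ p ∣ Nat.count (g · = 1) D)
    (hg2 : Nat.count (g₀ · = 2) D = Nat.count (g · = 2) D + 1)
    (hg : ∀ r, r + 1 < D → g r ≠ g (r + 1)) (hg₀ : ∀ r, r + 1 < D → g₀ r ≠ g₀ (r + 1))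
    (h1 : g (D - 1) ≠ g 0) (h2 : g₀ (D - 1) ≠ g 0) (h3 : g (D - 1) ≠ g₀ 0) :
    HasGrayCode ![p ^ a, p ^ b, p ^ e] 2 := by
  have hD2 : 2 ≤ D := hD ▸ hp.two_le.trans (Nat.le_self_pow ha.ne' p)
  have hM2 : 2 ≤ p ^ b := hp.two_le.trans (Nat.le_self_pow (by omega) p)
  let c : ℕ → Fin 3 := fun t => if t < D then g₀ t else g (t % D)
  have hc1 : ∀ t, c t = 1 ↔ g (t % D) = 1 := fun t => by
    by_cases h : t < D
    · simp only [c, if_pos h, Nat.mod_eq_of_lt h]; exact hg1 t h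
    · simp only [c, if_neg h]
  have hcount0 : ∀ i, ∀ r ≤ D, Nat.count (c · = i) r = Nat.count (g₀ · = i) r := fun i r => by
    induction r with
    | zero => simp
    | succ r ih =>
      intro hr
      rw [Nat.count_succ, Nat.count_succ, ih (by omega)]
      simp only [c, if_pos (show r < D by omega)]
  have hcount1 : ∀ r ≤ D, Nat.count (c · = 1) r = Nat.count (g · = 1) r := fun r => by
    induction r with
    | zero => simp
    | succ r ih =>
      intro hr
      rw [Nat.count_succ, Nat.count_succ, ih (by omega)]
      simp only [hc1, Nat.mod_eq_of_lt (show r < D by omega)]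
  have hcountk : ∀ i k, ∀ r ≤ D, Nat.count (c · = i) (D * (k + 1) + r) =
      Nat.count (c · = i) (D * (k + 1)) + Nat.count (g · = i) r := fun i k r => by
    induction r with
    | zero => simp
    | succ r ih =>
      intro hr
      have hlt : ¬ D * (k + 1) + r < D := by rw [Nat.mul_succ]; omega
      rw [← Nat.add_assoc, Nat.count_succ, Nat.count_succ, ih (by omega)]
      simp only [c, if_neg hlt, Nat.mul_add_mod_self_left, Nat.mod_eq_of_lt (show r < D by omega)]
      omega
  have hcount2 : ∀ k, Nat.count (c · = 2) (D * (k + 1)) = (k + 1) * Nat.count (g · = 2) D + 1 :=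
    fun k => by
    induction k with
    | zero => rw [zero_add, mul_one, hcount0 2 D le_rfl, hg2, one_mul]
    | succ k ih => rw [Nat.mul_succ, hcountk 2 k D le_rfl, ih]; ring
  have hper : ∀ t, Nat.count (c · = 1) (t + D) = Nat.count (c · = 1) t + Nat.count (g · = 1) D :=
    fun t => by
    induction t with
    | zero => rw [zero_add, hcount1 D le_rfl, Nat.count_zero, zero_add]
    | succ t ih =>
      rw [show t + 1 + D = t + D + 1 by omega, Nat.count_succ, Nat.count_succ, ih]
      simp only [hc1, Nat.add_mod_right]
      omega
  have hsum : ∀ t, Nat.count (c · = 1) t + (Nat.count (c · = 0) t + Nat.count (c · = 2) t) = t :=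
    fun t => by
    induction t with
    | zero => simp
    | succ t ih =>
      rw [Nat.count_succ, Nat.count_succ, Nat.count_succ]
      obtain h | h | h : c t = 0 ∨ c t = 1 ∨ c t = 2 := by
        generalize c t = i; fin_cases i <;> simp
      all_goals simp only [h]; simp; omega
  have hbent : ∀ t, c t ≠ c (t + 1) := fun t => by
    by_cases ht : t + 1 < D
    · simp only [c, if_pos ht, if_pos (show t < D by omega)]
      exact hg₀ t ht
    · have ht' : ¬ t + 1 < D := ht
      simp only [c, if_neg ht']
      by_cases ht2 : t < D
      · obtain rfl : t = D - 1 := by omega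
        rw [if_pos ht2, Nat.sub_add_cancel (by omega), Nat.mod_self]
        exact h2
      · rw [if_neg ht2]
        have e1 := Nat.mod_lt t (show 0 < D by omega)
        by_cases h : t % D + 1 < D
        · rw [Nat.add_mod, Nat.mod_eq_of_lt (show 1 < D by omega), Nat.mod_eq_of_lt h]
          exact hg _ h
        · have e2 : t % D = D - 1 := by omega
          rw [Nat.add_mod, Nat.mod_eq_of_lt (show 1 < D by omega), e2,
            Nat.sub_add_cancel (by omega), Nat.mod_self]
          exact h1
  -- The exponents are exchanged because the counted steps are those in dimension `1`, of size `p ^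
  -- b`.
  have hdvd := pow_dvd_sub_and_iff hp (a := b) (b := a) (by omega) hr hsum
    (by rw [min_eq_right hab, ← hD]; exact hper)
  have hN : D * p ^ b = p ^ b * p ^ a := by rw [hD, mul_comm]
  have hN0 : D * 2 ≤ D * p ^ b := Nat.mul_le_mul_left D hM2
  have hcast : ∀ u v, (((Nat.count (c · = 0) u + Nat.count (c · = 2) u : ℕ) : ℤ) -
      ((Nat.count (c · = 0) v + Nat.count (c · = 2) v : ℕ) : ℤ)) =
      (Nat.count (c · = 0) u : ℤ) + 1 * Nat.count (c · = 2) u -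
        (Nat.count (c · = 0) v + 1 * Nat.count (c · = 2) v) := fun u v => by push_cast; ring
  simp only [hcast] at hdvd
  obtain ⟨hT1, hT0⟩ := (hdvd (D * p ^ b) 0).2 ⟨1, by rw [hN]; push_cast; ring⟩
  -- The projection `(x + z, y)` does not distinguish the colours `0` and `2`.
  refine hasGrayCode_of_quotient (α := 1) (β := 0) (N := D * p ^ b)
    (P := fun t i => Nat.count (c · = i) t) (c := c) ?_ ?_ ?_ (by omega) ?_ ?_ ?_
    (fun t _ => hbent t) ?_ ?_ ?_ ?_ ?_
  · simpa using pow_dvd_pow (p : ℤ) hae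
  · simp
  · simp [hD]
  · simp
  · intro t _ i hi
    simp only [Nat.count_succ, if_neg (Ne.symm hi), add_zero]
  · intro t _
    left
    simp [Nat.count_succ]
  · have e1 : ¬ D * p ^ b - 1 < D := by omega
    have e2 : (D * p ^ b - 1) % D = D - 1 := by
      obtain ⟨M, hM⟩ : ∃ M, p ^ b = M + 1 := ⟨p ^ b - 1, by omega⟩
      rw [hM, Nat.mul_succ, Nat.add_sub_assoc (by omega), Nat.mul_add_mod_self_left]
      exact Nat.mod_eq_of_lt (by omega)
    simp only [c, if_neg e1, e2, if_pos (show 0 < D by omega)]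
    exact h3
  · intro s hs t ht d0 d1
    have := (hdvd s t).1 ⟨by simpa using d1, by simpa using d0⟩
    rw [← hN] at this
    have h' := Int.eq_zero_of_abs_lt_dvd this (by rw [abs_lt]; constructor <;> omega)
    omega
  · simpa using hT0
  · simpa using hT1
  · simp only [Matrix.cons_val]
    rw [Nat.isCoprime_iff_coprime]
    refine Nat.Coprime.pow_left _ ((hp.coprime_iff_not_dvd).2 fun h => ?_)
    -- The extra `2` in the first period makes the third displacement `1` modulo `p`.
    obtain ⟨M, hM⟩ : ∃ M, p ^ b = M + 1 := ⟨p ^ b - 1, by omega⟩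
    rw [hM, hcount2, ← hM, Nat.dvd_add_right ((dvd_pow_self p (by omega)).mul_right _)] at h
    exact hp.one_lt.ne' (Nat.dvd_one.1 h)

/-! ### Explicit colourings and paths -/

theorem hasGrayCode_two_pow {a b e : ℕ} (ha : 0 < a) (hab : a ≤ b) (hae : a ≤ e) :
    HasGrayCode ![2 ^ a, 2 ^ b, 2 ^ e] 2 := by
  obtain ⟨D, hD⟩ : ∃ D, D = 2 ^ a := ⟨_, rfl⟩
  obtain ⟨D', hD'⟩ : ∃ D', D = 2 * D' + 2 := by
    obtain ⟨a, rfl⟩ := Nat.exists_eq_add_of_lt ha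
    have := Nat.pow_pos (n := a) (show 0 < 2 by norm_num)
    exact ⟨2 ^ a - 1, by rw [hD, zero_add, pow_succ]; omega⟩
  -- The words are `0 2 0 … 2 0 1` and `2 0 2 … 0 2 1`. The alternating part has odd length `D - 1`,
  -- so exchanging `0` and `2` gains exactly one `2`.
  let g : ℕ → Fin 3 := fun r => if r = D - 1 then 1 else if r % 2 = 0 then 0 else 2
  let g₀ : ℕ → Fin 3 := fun r => if r = D - 1 then 1 else if r % 2 = 0 then 2 else 0
  have hcount : ∀ r < D, Nat.count (g · = 1) r = 0 ∧ Nat.count (g₀ · = 2) r = (r + 1) / 2 ∧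
      Nat.count (g · = 2) r = r / 2 := fun r => by
    induction r with
    | zero => simp
    | succ r ih =>
      intro hr
      obtain ⟨h1, h2, h3⟩ := ih (by omega)
      rw [Nat.count_succ, Nat.count_succ, Nat.count_succ, h1, h2, h3]
      have hr' : r ≠ D - 1 := by omega
      rcases Nat.mod_two_eq_zero_or_one r with h | h
      · simp [g, g₀, hr', h]; omega
      · simp [g, g₀, hr', h]; omega
  have hlast : Nat.count (g · = 1) D = 1 ∧
      Nat.count (g₀ · = 2) D = Nat.count (g · = 2) D + 1 := by
    obtain ⟨h1, h2, h3⟩ := hcount (D - 1) (by omega)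
    obtain ⟨E, hE⟩ : ∃ E, D = E + 1 := ⟨D - 1, by omega⟩
    have hE' : E = D - 1 := by omega
    rw [hE, Nat.count_succ, Nat.count_succ, Nat.count_succ, hE', h1, h2, h3]
    simp [g, g₀]; omega
  refine hasGrayCode_of_coloring Nat.prime_two ha hab hae hD (g := g) (g₀ := g₀) ?_ ?_ hlast.2
    ?_ ?_ ?_ ?_ ?_
  · intro r _
    simp only [g, g₀]
    split_ifs <;> simp
  · rw [hlast.1]; norm_num
  · intro r hr
    simp only [g]
    split_ifs <;> omega
  · intro r hr
    simp only [g₀]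
    split_ifs <;> omega
  · simp only [g]
    split_ifs <;> omega
  · simp only [g, g₀]
    split_ifs <;> omega
  · simp only [g, g₀]
    split_ifs <;> omega

theorem hasGrayCode_odd_pow {p : ℕ} (hp : p.Prime) (hp2 : p ≠ 2) {a b e : ℕ} (ha : 0 < a)
    (hab : a ≤ b) (hae : a ≤ e) (h5 : 5 ≤ p ^ a) :
    HasGrayCode ![p ^ a, p ^ b, p ^ e] 2 := by
  obtain ⟨D, hD⟩ : ∃ D, D = p ^ a := ⟨_, rfl⟩
  rw [← hD] at h5
  have hodd : D % 2 = 1 := by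
    rw [hD, ← Nat.odd_iff]; exact (hp.odd_of_ne_two hp2).pow
  -- The word is `0 1 0 2 0 2 … 0 2 1`. Its first letter lies cyclically between two `1`s, so `g₀`
  -- may change it to `2`. For `D = 3` the two `1`s would be adjacent.
  let g : ℕ → Fin 3 := fun r => if r = 1 ∨ r = D - 1 then 1 else if r % 2 = 0 then 0 else 2
  let g₀ : ℕ → Fin 3 := fun r => if r = 0 then 2 else g r
  have hcount1 : ∀ r < D, Nat.count (g · = 1) r = if 2 ≤ r then 1 else 0 := fun r => by
    induction r with
    | zero => simp
    | succ r ih =>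
      intro hr
      rw [Nat.count_succ, ih (by omega)]
      have hr' : r ≠ D - 1 := by omega
      simp only [g, hr', or_false]
      split_ifs <;> omega
  have hcount2 : ∀ r, Nat.count (g₀ · = 2) (r + 1) = Nat.count (g · = 2) (r + 1) + 1 := fun r => by
    induction r with
    | zero =>
      have : 0 ≠ D - 1 := by omega
      simp [Nat.count_succ, g, g₀, this]
    | succ r ih =>
      rw [Nat.count_succ, ih, Nat.count_succ _ (r + 1)]
      simp only [g₀, Nat.succ_ne_zero, if_false]
      omega
  obtain ⟨E, hE⟩ : ∃ E, D = E + 1 := ⟨D - 1, by omega⟩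
  have hlast : Nat.count (g · = 1) D = 2 := by
    have hE' : E = D - 1 := by omega
    rw [hE, Nat.count_succ, hcount1 E (by omega), if_pos (by omega)]
    simp [g, hE']
  refine hasGrayCode_of_coloring hp ha hab hae hD (g := g) (g₀ := g₀) ?_ ?_ ?_ ?_ ?_ ?_ ?_ ?_
  · intro r _
    simp only [g, g₀]
    split_ifs <;> omega
  · rw [hlast]
    exact fun h => hp2 ((Nat.prime_dvd_prime_iff_eq hp Nat.prime_two).1 h)
  · rw [hE]; exact hcount2 E
  · intro r hr
    simp only [g]
    split_ifs <;> omega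
  · intro r hr
    simp only [g, g₀]
    split_ifs <;> first | omega | (simp; done) | simp_all
  · have h0 : 0 ≠ D - 1 := by omega
    simp [g, h0]
  · have h0 : D - 1 ≠ 0 := by omega
    simp [g, g₀, h0, h0.symm]
  · simp only [g, g₀]
    split_ifs <;> omega

theorem hasGrayCode_three_three {e : ℕ} (he : 0 < e) : HasGrayCode ![3, 3, 3 ^ e] 2 := by
  let P : ℕ → Fin 3 → ℤ := fun t => [![0, 0, 0], ![1, 0, 0], ![1, 1, 0], ![1, 1, 1], ![1, 2, 1],
    ![1, 2, 0], ![0, 2, 0], ![0, 2, -1], ![1, 2, -1], ![1, 1, -1]].getD t 0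
  have hinj : ∀ s < 9, ∀ t < 9, (3 : ℤ) ∣ (P s 0 + 1 * P s 2) - (P t 0 + 1 * P t 2) →
      (3 : ℤ) ∣ (P s 1 + 1 * P s 2) - (P t 1 + 1 * P t 2) → s = t := by decide
  have hc : ∀ t < 8, ([0, 1, 2, 1, 2, 0, 2, 0, 1] : List (Fin 3)).getD t 0 ≠
      [0, 1, 2, 1, 2, 0, 2, 0, 1].getD (t + 1) 0 := by decide
  refine hasGrayCode_of_quotient (α := 1) (β := 1) (N := 9) (P := P)
    (c := fun t => [0, 1, 2, 1, 2, 0, 2, 0, 1].getD t 0) ?_ ?_ rfl (by norm_num)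
    (by decide) (by decide) (by decide) (fun t ht => hc t (by omega)) (by decide) hinj
    (show (3 : ℤ) ∣ P 9 0 + 1 * P 9 2 by decide) (show (3 : ℤ) ∣ P 9 1 + 1 * P 9 2 by decide) ?_
  · simpa using dvd_pow_self (3 : ℤ) he.ne'
  · simpa using dvd_pow_self (3 : ℤ) he.ne'
  · exact isCoprime_one_right.neg_right

/-- The projection is `(x, y - 2 z)`. Rounds of steps `0, 1, 2` alone would give a Hamiltonian cycle
of the quotient, but with third displacement `B`, a multiple of `3`. The last four rounds are
therefore replaced by a 12-step tail `V`, relative to `(k, k, k)`, which covers the same part of the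
quotient and changes the third displacement to `B - 2`. -/
theorem hasGrayCode_three_nine {B e : ℕ} (hB : 9 ≤ B) (h3 : 3 ∣ B) (hBe : B ∣ 3 ^ e) :
    HasGrayCode ![3, B, 3 ^ e] 2 := by
  obtain ⟨k, hk⟩ : ∃ k, B = k + 4 := ⟨B - 4, by omega⟩
  let V : ℕ → Fin 3 → ℤ := fun i => [![0, 0, 0], ![-1, 0, 0], ![-1, 0, 1], ![-1, 1, 1],
    ![-2, 1, 1], ![-2, 1, 0], ![-2, 0, 0], ![-2, 0, 1], ![-3, 0, 1], ![-3, 1, 1], ![-3, 1, 2],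
    ![-2, 1, 2], ![-2, 0, 2]].getD i 0
  let P : ℕ → Fin 3 → ℤ := fun t =>
    if t < 3 * k then
      ![(t / 3 : ℕ) + (if t % 3 = 0 then 0 else 1), (t / 3 : ℕ) + (if t % 3 = 2 then 1 else 0),
        (t / 3 : ℕ)]
    else fun i => k + V (t - 3 * k) i
  let c : ℕ → Fin 3 := fun t =>
    if t < 3 * k then (if t % 3 = 0 then 0 else if t % 3 = 1 then 1 else 2)
    else [0, 2, 1, 0, 2, 1, 2, 0, 1, 2, 0, 1].getD (t - 3 * k) 0
  have hP1 : ∀ j < k, P (3 * j) = ![(j : ℤ), j, j] ∧ P (3 * j + 1) = ![(j : ℤ) + 1, j, j] ∧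
      P (3 * j + 2) = ![(j : ℤ) + 1, j + 1, j] := fun j hj => by
    refine ⟨?_, ?_, ?_⟩
    · simp only [P, if_pos (show 3 * j < 3 * k by omega), Nat.mul_mod_right]
      simp
    · simp only [P, if_pos (show 3 * j + 1 < 3 * k by omega), Nat.mul_add_mod_self_left,
        Nat.mul_add_div (show 3 > 0 by norm_num)]
      simp
    · simp only [P, if_pos (show 3 * j + 2 < 3 * k by omega), Nat.mul_add_mod_self_left,
        Nat.mul_add_div (show 3 > 0 by norm_num)]
      simp
  have hc1 : ∀ j < k, c (3 * j) = 0 ∧ c (3 * j + 1) = 1 ∧ c (3 * j + 2) = 2 := fun j hj => by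
    refine ⟨?_, ?_, ?_⟩
    · simp only [c, if_pos (show 3 * j < 3 * k by omega), Nat.mul_mod_right]
      simp
    · simp only [c, if_pos (show 3 * j + 1 < 3 * k by omega), Nat.mul_add_mod_self_left]
      simp
    · simp only [c, if_pos (show 3 * j + 2 < 3 * k by omega), Nat.mul_add_mod_self_left]
      simp
  have hP2 : ∀ i, P (3 * k + i) = fun l => k + V i l := fun i => by
    simp only [P, if_neg (show ¬ 3 * k + i < 3 * k by omega), Nat.add_sub_cancel_left]
  have hc2 : ∀ i, c (3 * k + i) = [0, 2, 1, 0, 2, 1, 2, 0, 1, 2, 0, 1].getD i 0 := fun i => by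
    simp only [c, if_neg (show ¬ 3 * k + i < 3 * k by omega), Nat.add_sub_cancel_left]
  have hP3 : ∀ j < k, P (3 * j + 3) = ![(j : ℤ) + 1, j + 1, j + 1] := fun j hj => by
    by_cases h : j + 1 < k
    · have := (hP1 (j + 1) h).1
      rw [show 3 * j + 3 = 3 * (j + 1) by ring, this]
      push_cast; rfl
    · rw [show 3 * j + 3 = 3 * k + 0 by omega, hP2, show (k : ℤ) = j + 1 by omega]
      ext l; fin_cases l <;> simp [V]
  have hcases : ∀ t < 3 * B, (∃ j < k, t = 3 * j ∨ t = 3 * j + 1 ∨ t = 3 * j + 2) ∨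
      ∃ i < 12, t = 3 * k + i := fun t ht => by
    by_cases h : t < 3 * k
    · exact Or.inl ⟨t / 3, by omega, by omega⟩
    · exact Or.inr ⟨t - 3 * k, by omega, by omega⟩
  have hT : P (3 * B) = ![(k : ℤ) - 2, k, k + 2] := by
    rw [hk, show 3 * (k + 4) = 3 * k + 12 by ring, hP2]
    ext l; fin_cases l <;> simp [V]; ring
  refine hasGrayCode_of_quotient (α := 0) (β := -2) (N := 3 * B) (P := P) (c := c) ?_ ?_ ?_
    (by omega) ?_ ?_ ?_ ?_ ?_ ?_ ?_ ?_ ?_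
  · simp
  · have : (B : ℤ) ∣ 3 ^ e := by exact_mod_cast hBe
    simpa using this.mul_left 2
  · simp
  · intro i
    rw [show 0 = 3 * 0 by rfl, (hP1 0 (by omega)).1]
    fin_cases i <;> rfl
  · intro t ht l hl
    rcases hcases t ht with ⟨j, hj, rfl | rfl | rfl⟩ | ⟨i, hi, rfl⟩
    · rw [(hc1 j hj).1] at hl
      rw [(hP1 j hj).1, (hP1 j hj).2.1]
      fin_cases l <;> simp_all
    · rw [(hc1 j hj).2.1] at hl
      rw [(hP1 j hj).2.2, (hP1 j hj).2.1]
      fin_cases l <;> simp_all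
    · rw [(hc1 j hj).2.2] at hl
      rw [(hP1 j hj).2.2, hP3 j hj]
      fin_cases l <;> simp_all
    · rw [hc2] at hl
      rw [add_assoc, hP2, hP2]
      have : ∀ i < 12, ∀ l, l ≠ [0, 2, 1, 0, 2, 1, 2, 0, 1, 2, 0, 1].getD i 0 →
          V (i + 1) l = V i l := by decide
      simp only [this i hi l hl]
  · intro t ht
    rcases hcases t ht with ⟨j, hj, rfl | rfl | rfl⟩ | ⟨i, hi, rfl⟩
    · rw [(hc1 j hj).1, (hP1 j hj).1, (hP1 j hj).2.1]
      simp
    · rw [(hc1 j hj).2.1, (hP1 j hj).2.2, (hP1 j hj).2.1]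
      simp
    · rw [(hc1 j hj).2.2, (hP1 j hj).2.2, hP3 j hj]
      simp
    · rw [hc2, add_assoc, hP2, hP2]
      have : ∀ i < 12, V (i + 1) ([0, 2, 1, 0, 2, 1, 2, 0, 1, 2, 0, 1].getD i 0) =
          V i ([0, 2, 1, 0, 2, 1, 2, 0, 1, 2, 0, 1].getD i 0) + 1 ∨
          V (i + 1) ([0, 2, 1, 0, 2, 1, 2, 0, 1, 2, 0, 1].getD i 0) =
          V i ([0, 2, 1, 0, 2, 1, 2, 0, 1, 2, 0, 1].getD i 0) - 1 := by decide
      rcases this i hi with h | h <;> simp only [h]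
      · left; ring
      · right; ring
  · intro t ht
    rcases hcases t (by omega) with ⟨j, hj, rfl | rfl | rfl⟩ | ⟨i, hi, rfl⟩
    · rw [(hc1 j hj).1, (hc1 j hj).2.1]; decide
    · rw [(hc1 j hj).2.1, (hc1 j hj).2.2]; decide
    · rw [(hc1 j hj).2.2]
      by_cases h : j + 1 < k
      · rw [show 3 * j + 2 + 1 = 3 * (j + 1) by ring, (hc1 _ h).1]; decide
      · rw [show 3 * j + 2 + 1 = 3 * k + 0 by omega, hc2]; decide
    · rw [add_assoc, hc2, hc2]
      have hi' : i < 11 := by omega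
      clear hi ht
      revert i
      decide
  · rw [show 3 * B - 1 = 3 * k + 11 by omega, hc2, show 0 = 3 * 0 by rfl, (hc1 0 (by omega)).1]
    decide
  · have hform : ∀ t < 3 * B,
        (∃ j < k, (t = 3 * j ∧ P t 0 = j ∧ P t 1 + -2 * P t 2 = -j) ∨
          (t = 3 * j + 1 ∧ P t 0 = j + 1 ∧ P t 1 + -2 * P t 2 = -j) ∨
          (t = 3 * j + 2 ∧ P t 0 = j + 1 ∧ P t 1 + -2 * P t 2 = 1 - j)) ∨
        ∃ i < 12, t = 3 * k + i ∧ P t 0 = k + V i 0 ∧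
          P t 1 + -2 * P t 2 = -k + (V i 1 - 2 * V i 2) := fun t ht => by
      rcases hcases t ht with ⟨j, hj, rfl | rfl | rfl⟩ | ⟨i, hi, rfl⟩
      · left
        refine ⟨j, hj, ?_⟩
        rw [(hP1 j hj).1]
        left; simp; ring
      · left
        refine ⟨j, hj, ?_⟩
        rw [(hP1 j hj).2.1]
        right; left; simp; ring
      · left
        refine ⟨j, hj, ?_⟩
        rw [(hP1 j hj).2.2]
        right; right; simp; ring
      · right
        refine ⟨i, hi, rfl, ?_, ?_⟩
        · rw [hP2]
        · rw [hP2]; ring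
    have hVinj : ∀ i < 12, ∀ i' < 12, (3 : ℤ) ∣ V i 0 - V i' 0 →
        V i 1 - 2 * V i 2 = V i' 1 - 2 * V i' 2 → i = i' := by decide
    -- The tail shares just two rows `y - 2 z` with the rounds. In row `1 - k` the last round leaves
    -- only `x ≡ k - 2`. Row `-k - 3` is row `1` modulo `B`, where the initial round has taken `x =
    -- 1 ≡ k - 1`.
    have hVbd : ∀ i < 12, -3 ≤ V i 1 - 2 * V i 2 ∧ V i 1 - 2 * V i 2 ≤ 1 ∧
        -3 ≤ V i 0 ∧ V i 0 ≤ 0 ∧ (V i 1 - 2 * V i 2 = 1 → V i 0 = -2) ∧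
        (V i 1 - 2 * V i 2 = -3 → V i 0 ≠ -1 ∧ V i 0 ≠ 0) := by decide
    intro s hs t ht h1 h2
    have hst := hform s hs
    have hst' := hform t ht
    rw [zero_mul, add_zero, zero_mul, add_zero] at h1
    simp only [Matrix.cons_val, Nat.cast_ofNat] at h1 h2
    generalize P s 0 = x at *
    generalize P t 0 = x' at *
    generalize P s 1 + -2 * P s 2 = y at *
    generalize P t 1 + -2 * P t 2 = y' at *
    obtain ⟨b, rfl⟩ := h3
    have hy : -(k + 3 : ℤ) ≤ y ∧ y ≤ 1 := by
      rcases hst with ⟨j, hj, h⟩ | ⟨i, hi, h⟩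
      · clear * - hj h; omega
      · have := hVbd i hi; clear * - h this; omega
    have hy' : -(k + 3 : ℤ) ≤ y' ∧ y' ≤ 1 := by
      rcases hst' with ⟨j, hj, h⟩ | ⟨i, hi, h⟩
      · clear * - hj h; omega
      · have := hVbd i hi; clear * - h this; omega
    obtain ⟨q, hq⟩ := h2
    -- All rows lie in an interval of length `B = k + 4`, so congruent rows are equal or are its two
    -- ends.
    have hq' : y - y' = 0 ∨ y - y' = k + 4 ∨ y - y' = -(k + 4) := by
      rw [hk] at hq
      push_cast at hq
      have hq1 : q < 2 := by nlinarith
      have hq2 : -2 < q := by nlinarith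
      clear * - hq hq1 hq2
      interval_cases q <;> omega
    rcases hst with ⟨j, hj, h⟩ | ⟨i, hi, rfl, rfl, rfl⟩ <;>
      rcases hst' with ⟨j', hj', h'⟩ | ⟨i', hi', rfl, rfl, rfl⟩
    · clear * - hj h hj' h' hq' h1 hk
      rcases h with h | h | h <;> rcases h' with h' | h' | h' <;> omega
    · have := hVbd i' hi'
      clear * - hj h this hq' h1 hk
      generalize V i' 0 = u at *
      generalize V i' 1 - 2 * V i' 2 = v at *
      rcases h with h | h | h <;> omega
    · have := hVbd i hi
      clear * - hj' h' this hq' h1 hk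
      generalize V i 0 = u at *
      generalize V i 1 - 2 * V i 2 = v at *
      rcases h' with h | h | h <;> omega
    · have e1 := hVbd i hi
      have e2 := hVbd i' hi'
      have := hVinj i hi i' hi' (by simpa using h1) (by
        clear * - e1 e2 hq' hk hB
        omega)
      rw [this]
  · obtain ⟨b, rfl⟩ := h3
    rw [hT]
    exact ⟨b - 2, by simp; omega⟩
  · rw [hT]
    exact ⟨-1, by simp; omega⟩
  · obtain ⟨b, rfl⟩ := h3
    rw [hT]
    simp only [Matrix.cons_val, Nat.cast_pow, Nat.cast_ofNat]
    exact IsCoprime.pow_left ⟨1 - b, 1, by omega⟩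

/-- After sorting, the smallest size comes first, as the colourings require. The only odd prime
power below `5` is `3`, which leaves `3, 3^b, 3^e` to the explicit paths. -/
theorem hasGrayCode_three {p : ℕ} (hp : p.Prime) (c : Fin 3 → ℕ) (hc : ∀ i, 0 < c i) :
    HasGrayCode (fun i => p ^ c i) 2 := by
  refine HasGrayCode.of_equiv (Tuple.sort c) ?_
  have hmono := Tuple.monotone_sort c
  have h01 : c (Tuple.sort c 0) ≤ c (Tuple.sort c 1) := hmono (by decide)
  have h12 : c (Tuple.sort c 1) ≤ c (Tuple.sort c 2) := hmono (by decide)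
  have ha := hc (Tuple.sort c 0)
  have he : (fun i => p ^ c i) ∘ Tuple.sort c =
      ![p ^ c (Tuple.sort c 0), p ^ c (Tuple.sort c 1), p ^ c (Tuple.sort c 2)] := by
    ext i; fin_cases i <;> rfl
  rw [he]
  generalize c (Tuple.sort c 0) = a at *
  generalize c (Tuple.sort c 1) = b at *
  generalize c (Tuple.sort c 2) = e at *
  by_cases hp2 : p = 2
  · subst hp2
    exact hasGrayCode_two_pow ha h01 (h01.trans h12)
  by_cases h5 : 5 ≤ p ^ a
  · exact hasGrayCode_odd_pow hp hp2 ha h01 (h01.trans h12) h5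
  have hple : p ≤ p ^ a := Nat.le_self_pow ha.ne' p
  have hp3 : p = 3 := by
    have := hp.two_le
    have : p ≠ 4 := by rintro rfl; revert hp; norm_num
    omega
  subst hp3
  have ha1 : a = 1 := by
    by_contra h
    have := Nat.pow_le_pow_right (show 0 < 3 by norm_num) (show 2 ≤ a by omega)
    omega
  subst ha1
  rw [pow_one]
  by_cases hb : b = 1
  · subst hb
    exact hasGrayCode_three_three (by omega)
  · exact hasGrayCode_three_nine
      (by simpa using Nat.pow_le_pow_right (show 0 < 3 by norm_num) (show 2 ≤ b by omega))
      (dvd_pow_self 3 (by omega)) (pow_dvd_pow 3 h12)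

/-- The inequality includes the existence of a Hamiltonian cycle, since `mrl` is `0` when there is
none. -/
theorem mainTheorem7 (p : ℕ) (hp : p.Prime) (n r : ℕ) (hr : 0 < r)
    (m : Fin (3 * n) → ℕ) (hm : ∀ i, 2 ≤ m i) (hG : Fintype.card (∀ i, Fin (m i)) = p ^ r) :
    n + 1 ≤ mrl (torus m) := by
  have hprod : ∏ i, m i = p ^ r := by simpa using hG
  have hpow : ∀ i, ∃ a, 0 < a ∧ m i = p ^ a := fun i => by
    obtain ⟨a, -, ha⟩ := (Nat.dvd_prime_pow hp).1
      (hprod ▸ Finset.dvd_prod_of_mem m (Finset.mem_univ i))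
    refine ⟨a, Nat.pos_of_ne_zero ?_, ha⟩
    rintro rfl
    have := hm i
    rw [ha, pow_zero] at this
    omega
  choose c hc hmc using hpow
  obtain rfl : m = fun i => p ^ c i := funext hmc
  -- For `n = 0` the torus is a single vertex, contrary to `0 < r`.
  have hn : 0 < n := Nat.pos_of_ne_zero fun h => by
    subst h
    exact (Nat.one_lt_pow hr.ne' hp.one_lt).ne hprod
  have hN : 3 ≤ ∏ i, p ^ c i := by
    calc 3 ≤ 2 ^ 3 := by norm_num
      _ ≤ 2 ^ (3 * n) := Nat.pow_le_pow_right (by norm_num) (by omega)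
      _ = ∏ _i : Fin (3 * n), 2 := by simp
      _ ≤ _ := Finset.prod_le_prod' fun i _ => hm i
  obtain ⟨f, d, h⟩ := hasGrayCode_of_three hp (hasGrayCode_three hp) n hn (Fin (3 * n)) (by simp)
    c hc
  exact h.le_mrl hm hN
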